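/- **Theorem 3.** Let $h:\mathbb{R}^d\to\mathbb{R}^d$ be measurable and locally bounded (possibly discontinuous; this covers every measurable $h$ with at most linear growth), and let $$x(n+1)=x(n)+a(n)\big(h(x(n))+M(n+1)\big),\qquad n\ge 0,$$ where $a(n)\ge 0$, $\sum_n a(n)=\infty$, $\sum_n a(n)^2<\infty$, and $\{M(n)\}$ is a martingale difference sequence with respect to $\mathcal{F}_n=\sigma(x(m),M(m),\,m\le n)$, that is, $E[M(n+1)\mid\mathcal{F}_n]=0$ for all $n\ge 0$, with $E\|M(n)\|^2<\infty$ for all $n$ and $E[\|M(n+1)\|^2\mid\mathcal{F}_n]\le K(1+\|x(n)\|^2)$ a.s. for all $n \geq 0$ and some constant $K$. Assume that $\sup_n\|x(n)\|<\infty$ a.s. and that, for every $n\ge 0$, the law of $(x(n),M(n+1))$ is absolutely continuous with respect to Lebesgue measure on $\mathbb{R}^d\times\mathbb{R}^d$. Let $$F_h(x)=\bigcap_{N\ \text{Lebesgue-null}}\ \bigcap_{\delta>0}\overline{\mathrm{co}}\,\big\{h(y): \|y-x\|<\delta,\ y\notin N\big\}$$ be the Filippov set-valued map of $h$. Put $t(0)=0$,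 $t(n)=\sum_{m<n}a(m)$, let $\bar x:[0,\infty)\to\mathbb{R}^d$ be the piecewise linear interpolation with $\bar x(t(n))=x(n)$, and for $T>0$ let $m(n)=\min\{k:t(k)\ge t(n)+T\}$. Then, almost surely, $\bar x$ asymptotically tracks Filippov solutions of $\dot x=h(x)$: for every $T>0$ there are absolutely continuous $y^n:[t(n),t(m(n))]\to\mathbb{R}^d$, $n\ge 0$, with $\dot y^n(t)\in F_h(y^n(t))$ for almost every $t$, such that $$\lim_{n\to\infty}\ \sup_{t\in[t(n),t(m(n))]}\|\bar x(t)-y^n(t)\|=0 ,$$ and in particular $y^n(t(n))-x(n)\to 0$. -/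

import Mathlib

open MeasureTheory Filter Topology Set

noncomputable section

namespace StochApprox

/-- The algorithmic time scale `t(n) = a(0) + ... + a(n-1)`, with `t(0) = 0`. -/
def time (a : ℕ → ℝ) (n : ℕ) : ℝ := ∑ m ∈ Finset.range n, a m

/-- The piece of the time scale that contains `s`: the least `k` with `s < t(k+1)`.
If `a ≥ 0` has infinite sum and `0 ≤ s`, then `t(k) ≤ s < t(k+1)`, so that `a(k) > 0`. -/
def pieceIndex (a : ℕ → ℝ) (s : ℝ) : ℕ := sInf {k : ℕ | s < time a (k + 1)}

/-- The interpolated trajectory: the value at time `t(n)` is `x(n)`, with linear interpolation on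
each interval `[t(n), t(n+1)]`. -/
def interpolation {E : Type*} [AddCommGroup E] [Module ℝ E] (a : ℕ → ℝ) (x : ℕ → E) (s : ℝ) : E :=
  x (pieceIndex a s) +
    ((s - time a (pieceIndex a s)) / a (pieceIndex a s)) •
      (x (pieceIndex a s + 1) - x (pieceIndex a s))

/-- `m(n) = min {k : t(k) ≥ t(n) + T}`. -/
def horizonIndex (a : ℕ → ℝ) (T : ℝ) (n : ℕ) : ℕ := sInf {k : ℕ | time a n + T ≤ time a k}

/-- The sigma-algebra `F_n` generated by `x(m), M(m)` for `m ≤ n`. -/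
abbrev history {Ω E : Type*} [MeasurableSpace E] (x M : ℕ → Ω → E) (n : ℕ) : MeasurableSpace Ω :=
  ⨆ m : Fin (n + 1),
    (MeasurableSpace.comap (x m) inferInstance ⊔ MeasurableSpace.comap (M m) inferInstance)

/-- The Filippov set-valued map of `h`: the intersection, over all Lebesgue-null sets `N` and all
`δ > 0`, of the closed convex hull of the values of `h` on the `δ`-ball around `x` without `N`. -/
def filippovMap {d : ℕ} (h : EuclideanSpace ℝ (Fin d) → EuclideanSpace ℝ (Fin d))
    (x : EuclideanSpace ℝ (Fin d)) : Set (EuclideanSpace ℝ (Fin d)) :=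
  ⋂ (N : Set (EuclideanSpace ℝ (Fin d))) (_ : volume N = 0) (δ : ℝ) (_ : 0 < δ),
    closure (convexHull ℝ (h '' (Metric.ball x δ \ N)))

/-- `y` is a solution on `[b, c]` of the differential inclusion `y' ∈ H(y)`: it is absolutely
continuous there, and at almost every time it has a derivative, which lies in `H(y)`. -/
def IsInclusionSolution {d : ℕ}
    (H : EuclideanSpace ℝ (Fin d) → Set (EuclideanSpace ℝ (Fin d)))
    (y : ℝ → EuclideanSpace ℝ (Fin d)) (b c : ℝ) : Prop :=
  AbsolutelyContinuousOnInterval y b c ∧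
    ∀ᵐ s ∂(volume.restrict (Icc b c)), ∃ v ∈ H (y s), HasDerivAt y v s

/-- `y` is a Filippov solution of `y' = h(y)` on `[b, c]`. -/
def IsFilippovSolution {d : ℕ} (h : EuclideanSpace ℝ (Fin d) → EuclideanSpace ℝ (Fin d))
    (y : ℝ → EuclideanSpace ℝ (Fin d)) (b c : ℝ) : Prop :=
  IsInclusionSolution (filippovMap h) y b c

end StochApprox

end

/-! A single Lebesgue-null set `N₀` suffices to compute the Filippov map from above, and absolute
continuity keeps every iterate off `N₀` almost surely. All drifts `h (x k)` are then admissible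
values for the Filippov hulls at nearby points, and the rest is pathwise.

The weighted noise converges almost surely, so the interpolation is asymptotic to a Lipschitz path
`driftPath`, the integral of a step function with values `h (x k)`. Difference quotients of this
path are averages of values of `h` at nearby iterates, so they lie in closed convex hulls. Hence
every ultrafilter limit of its time shifts is a Filippov solution (`exists_ultrafilter_limit`).
Equicontinuity makes these limits uniform on compact windows, so the least tracking error over all
solutions tends to zero along every ultrafilter, hence along `n → ∞`; near-minimizers are the
required `y n` (`exists_tracking_solutions`). -/

namespace StochApprox

/-! ### One null set for the Filippov map -/

section NullSet

/-- For an arbitrary map between second countable spaces there is a null set outside of which every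
value is approximated, near its argument, by values off any prescribed null set. -/
theorem exists_null_forall_mem_closure_image {X Y : Type*} [TopologicalSpace X]
    [SecondCountableTopology X] [MeasurableSpace X] [TopologicalSpace Y]
    [SecondCountableTopology Y] (μ : Measure X) (f : X → Y) :
    ∃ N₀ : Set X, μ N₀ = 0 ∧ ∀ y ∉ N₀, ∀ N : Set X, μ N = 0 → ∀ U : Set X, IsOpen U → y ∈ U →
      f y ∈ closure (f '' (U \ N)) := by
  obtain ⟨B, hBc, -, hB⟩ := TopologicalSpace.exists_countable_basis X
  obtain ⟨B', hBc', -, hB'⟩ := TopologicalSpace.exists_countable_basis Y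
  -- Discard every null piece `U ∩ f ⁻¹' V` with `U`, `V` basic; there are countably many. At a
  -- remaining point all such pieces have positive measure, so none is contained in a null set `N`.
  refine ⟨⋃ U ∈ B, ⋃ V ∈ B', ⋃ (_ : μ (U ∩ f ⁻¹' V) = 0), U ∩ f ⁻¹' V, ?_, ?_⟩
  · refine (measure_biUnion_null_iff hBc).2 fun U _ => (measure_biUnion_null_iff hBc').2 fun V _ => ?_
    by_cases h0 : μ (U ∩ f ⁻¹' V) = 0
    · simp [h0]
    · simp [h0]
  · intro y hy N hN U hU hyU
    rw [hB'.mem_closure_iff]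
    intro V hV hyV
    obtain ⟨U', hU', hyU', hUU⟩ := hB.exists_subset_of_mem_open hyU hU
    have hne : μ (U' ∩ f ⁻¹' V) ≠ 0 := by
      intro h0
      apply hy
      simp only [mem_iUnion]
      exact ⟨U', hU', V, hV, h0, hyU', hyV⟩
    have hne' : ((U' ∩ f ⁻¹' V) \ N).Nonempty := by
      rw [nonempty_iff_ne_empty]
      intro he
      exact hne (measure_mono_null (sdiff_eq_empty.1 he) hN)
    obtain ⟨z, ⟨hzU, hzV⟩, hzN⟩ := hne'
    exact ⟨f z, hzV, z, ⟨hUU hzU, hzN⟩, rfl⟩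

/-- One null set computes the Filippov map from above. -/
theorem exists_null_filippovMap {d : ℕ} (h : EuclideanSpace ℝ (Fin d) → EuclideanSpace ℝ (Fin d)) :
    ∃ N₀ : Set (EuclideanSpace ℝ (Fin d)), volume N₀ = 0 ∧ ∀ x v,
      (∀ δ > 0, v ∈ closure (convexHull ℝ (h '' (Metric.ball x δ \ N₀)))) → v ∈ filippovMap h x := by
  obtain ⟨N₀, hN₀, H⟩ := exists_null_forall_mem_closure_image volume h
  refine ⟨N₀, hN₀, fun x v hv => ?_⟩
  simp only [filippovMap, mem_iInter]
  intro N hN δ hδ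
  refine closure_minimal (convexHull_min ?_ (convex_convexHull ℝ _).closure) isClosed_closure
    (hv δ hδ)
  rintro _ ⟨y, ⟨hy, hyN⟩, rfl⟩
  exact closure_mono (subset_convexHull ℝ _) (H y hyN N hN _ Metric.isOpen_ball hy)

end NullSet

/-! ### The algorithmic time scale -/

section TimeScale

variable {a : ℕ → ℝ}

theorem time_zero (a : ℕ → ℝ) : time a 0 = 0 := by simp [time]

theorem time_succ (a : ℕ → ℝ) (n : ℕ) : time a (n + 1) = time a n + a n :=
  Finset.sum_range_succ _ _

theorem time_mono (ha : ∀ n, 0 ≤ a n) : Monotone (time a) :=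
  monotone_nat_of_le_succ fun n => by rw [time_succ]; linarith [ha n]

theorem time_nonneg (ha : ∀ n, 0 ≤ a n) (n : ℕ) : 0 ≤ time a n :=
  Finset.sum_nonneg fun k _ => ha k

theorem lt_time_pieceIndex_succ (ht : Tendsto (time a) atTop atTop) (s : ℝ) :
    s < time a (pieceIndex a s + 1) := by
  have hne : {k : ℕ | s < time a (k + 1)}.Nonempty :=
    (((tendsto_add_atTop_iff_nat 1).2 ht).eventually_gt_atTop s).exists
  exact Nat.sInf_mem hne

theorem time_pieceIndex_le {s : ℝ} (hs : 0 ≤ s) : time a (pieceIndex a s) ≤ s := by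
  rcases hk : pieceIndex a s with _ | k
  · rwa [time_zero]
  · by_contra hlt
    have : pieceIndex a s ≤ k := Nat.sInf_le (not_le.1 hlt)
    omega

theorem pieceIndex_mono (ht : Tendsto (time a) atTop atTop) : Monotone (pieceIndex a) :=
  fun _ s' h => Nat.sInf_le (h.trans_lt (lt_time_pieceIndex_succ ht s'))

theorem le_pieceIndex (ha : ∀ n, 0 ≤ a n) (ht : Tendsto (time a) atTop atTop) {k : ℕ} {s : ℝ}
    (hs : time a k ≤ s) : k ≤ pieceIndex a s := by
  by_contra! hlt
  exact ((lt_time_pieceIndex_succ ht s).trans_le (time_mono ha hlt)).not_ge hs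

theorem pieceIndex_eq (ha : ∀ n, 0 ≤ a n) (ht : Tendsto (time a) atTop atTop) {k : ℕ} {s : ℝ}
    (hs : time a k ≤ s) (hs' : s < time a (k + 1)) : pieceIndex a s = k :=
  le_antisymm (Nat.sInf_le hs') (le_pieceIndex ha ht hs)

theorem tendsto_pieceIndex (ha : ∀ n, 0 ≤ a n) (ht : Tendsto (time a) atTop atTop) :
    Tendsto (pieceIndex a) atTop atTop :=
  tendsto_atTop.2 fun k => (eventually_ge_atTop (time a k)).mono fun _ hs => le_pieceIndex ha ht hs

theorem time_horizonIndex_le {A T : ℝ} (ha : ∀ n, a n ≤ A) (hA : 0 ≤ A)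
    (hnn : ∀ n, 0 ≤ a n) (hT : 0 < T) (n : ℕ) :
    time a (horizonIndex a T n) ≤ time a n + (T + A) := by
  rcases hk : horizonIndex a T n with _ | k
  -- Index `0` is also the value of `sInf` on an empty set; the bound holds there too.
  · rw [time_zero]
    linarith [time_nonneg hnn n]
  · have hlt : time a k < time a n + T := by
      by_contra! hle
      have : horizonIndex a T n ≤ k := Nat.sInf_le hle
      omega
    rw [time_succ]
    linarith [ha k]

end TimeScale

/-! ### Integrals of the step drift -/

section Drift

theorem intervalIntegrable_drift {E : Type*} [NormedAddCommGroup E] {a : ℕ → ℝ} {v : ℕ → E} {C : ℝ}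
    (ht : Tendsto (time a) atTop atTop) (hv : ∀ k, ‖v k‖ ≤ C)
    (b c : ℝ) : IntervalIntegrable (fun r => v (pieceIndex a r)) volume b c := by
  refine (intervalIntegrable_const (c := C)).mono_fun ?_ ?_
  · have h1 : StronglyMeasurable v := StronglyMeasurable.of_discrete
    exact (h1.comp_measurable (pieceIndex_mono ht).measurable).aestronglyMeasurable
  · exact Eventually.of_forall fun r => (hv _).trans (le_abs_self C)

variable {E : Type*} [NormedAddCommGroup E] [NormedSpace ℝ E] {a : ℕ → ℝ} {v : ℕ → E} {C : ℝ}

/-- The integral of the step function that takes the value `v k` on `[t(k), t(k+1))`. -/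
noncomputable def integratedDrift (a : ℕ → ℝ) (v : ℕ → E) (s : ℝ) : E :=
  ∫ r in (0 : ℝ)..s, v (pieceIndex a r)

theorem integratedDrift_sub (ht : Tendsto (time a) atTop atTop) (hv : ∀ k, ‖v k‖ ≤ C) (b c : ℝ) :
    integratedDrift a v c - integratedDrift a v b = ∫ r in b..c, v (pieceIndex a r) :=
  intervalIntegral.integral_interval_sub_left (intervalIntegrable_drift ht hv _ _)
    (intervalIntegrable_drift ht hv _ _)

theorem norm_integratedDrift_sub_le (ht : Tendsto (time a) atTop atTop) (hv : ∀ k, ‖v k‖ ≤ C)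
    (b c : ℝ) : ‖integratedDrift a v c - integratedDrift a v b‖ ≤ C * |c - b| := by
  rw [integratedDrift_sub ht hv]
  exact intervalIntegral.norm_integral_le_of_norm_le_const fun r _ => hv _

theorem integratedDrift_time [CompleteSpace E] (ha : ∀ n, 0 ≤ a n)
    (ht : Tendsto (time a) atTop atTop)
    (hv : ∀ k, ‖v k‖ ≤ C) (n : ℕ) :
    integratedDrift a v (time a n) = ∑ k ∈ Finset.range n, a k • v k := by
  induction n with
  | zero => simp [time_zero, integratedDrift]
  | succ n ih =>
    have hle : time a n ≤ time a (n + 1) := time_mono ha n.le_succ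
    -- The integrand is constant on the half-open `[t(n), t(n+1))`, hence the passage from `Ioc` to
    -- `Ico`. A zero step gives an empty interval.
    rw [Finset.sum_range_succ, ← ih, ← sub_eq_iff_eq_add', integratedDrift_sub ht hv,
      intervalIntegral.integral_of_le hle, ← integral_Ico_eq_integral_Ioc,
      setIntegral_congr_fun measurableSet_Ico
        (g := fun _ => v n) fun r hr => by rw [pieceIndex_eq ha ht hr.1 hr.2]]
    simp [time_succ, ha n]

/-- A difference quotient is an average of drift values, and averages stay in closed convex sets. -/
theorem integratedDrift_slope_mem [CompleteSpace E] (ht : Tendsto (time a) atTop atTop)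
    (hv : ∀ k, ‖v k‖ ≤ C) {G : Set E} (hG : Convex ℝ G) (hGc : IsClosed G) {b c : ℝ} (hbc : b < c)
    (hmem : ∀ r ∈ Icc b c, v (pieceIndex a r) ∈ G) :
    (c - b)⁻¹ • (integratedDrift a v c - integratedDrift a v b) ∈ G := by
  rw [integratedDrift_sub ht hv, ← interval_average_eq, uIoc_of_le hbc.le]
  refine hG.set_average_mem hGc (by simp [hbc]) (by simp) ?_ (intervalIntegrable_drift ht hv b c).1
  exact (ae_restrict_iff' measurableSet_Ioc).2
    (Eventually.of_forall fun r hr => hmem r (Ioc_subset_Icc_self hr))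

end Drift

/-! ### Pointwise to uniform convergence -/

section Limit

variable {E : Type*} [NormedAddCommGroup E]

theorem tendstoUniformlyOn_of_lipschitz {ι X : Type*} [PseudoMetricSpace X]
    {f : ι → X → E} {y : X → E} {C : NNReal} {l : Filter ι} (hf : ∀ i, LipschitzWith C (f i))
    (hy : LipschitzWith C y) (hlim : ∀ s, Tendsto (fun i => f i s) l (𝓝 (y s))) {S : Set X}
    (hS : TotallyBounded S) : TendstoUniformlyOn f y l S := by
  rw [Metric.tendstoUniformlyOn_iff]
  intro ε hε
  -- `C + 1` in place of `C` keeps the radius meaningful when `C = 0`.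
  obtain ⟨F, hF, hcov⟩ := Metric.totallyBounded_iff.1 hS (ε / (3 * (C + 1))) (by positivity)
  have hev : ∀ᶠ i in l, ∀ z ∈ F, dist (f i z) (y z) < ε / 3 :=
    (eventually_all_finite hF).2 fun z _ =>
      (Metric.tendsto_nhds.1 (hlim z)) (ε / 3) (by positivity)
  filter_upwards [hev] with i hi s hs
  obtain ⟨z, hz, hsz⟩ := mem_iUnion₂.1 (hcov hs)
  have hCs : C * dist s z ≤ ε / 3 := by
    have h1 : dist s z ≤ ε / (3 * (C + 1)) := (Metric.mem_ball.1 hsz).le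
    calc (C : ℝ) * dist s z ≤ (C + 1) * (ε / (3 * (C + 1))) := by
          gcongr; linarith
      _ = ε / 3 := by field_simp
  have h1 := hy.dist_le_mul s z
  have h2 := (hf i).dist_le_mul s z
  have h3 := hi z hz
  have h4 : dist (y s) (f i s) ≤ dist (y s) (y z) + dist (y z) (f i z) + dist (f i z) (f i s) :=
    dist_triangle4 _ _ _ _
  rw [dist_comm (y z), dist_comm (f i z) (f i s)] at h4
  linarith

end Limit

/-! ### Convergence of L²-bounded martingales -/

section Martingale

variable {Ω : Type*} {mΩ : MeasurableSpace Ω} {μ : Measure Ω} [IsProbabilityMeasure μ]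

/-- Square-summable real martingale differences have an almost surely convergent sum. -/
theorem ae_exists_tendsto_sum_of_condExp_eq_zero {𝓕 : Filtration ℕ mΩ} {D : ℕ → Ω → ℝ} {c : ℕ → ℝ}
    (hD_meas : ∀ n, StronglyMeasurable[𝓕 (n + 1)] (D n)) (hD_L2 : ∀ n, MemLp (D n) 2 μ)
    (hD_zero : ∀ n, μ[D n | 𝓕 n] =ᵐ[μ] 0) (hD_sq : ∀ n, ∫ ω, D n ω ^ 2 ∂μ ≤ c n)
    (hc : Summable c) :
    ∀ᵐ ω ∂μ, ∃ l, Tendsto (fun n => ∑ k ∈ Finset.range n, D k ω) atTop (𝓝 l) := by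
  set S : ℕ → Ω → ℝ := fun n ω => ∑ k ∈ Finset.range n, D k ω with hS
  have hS_succ : ∀ n, S (n + 1) = S n + D n := fun n => by
    ext ω; simp [hS, Finset.sum_range_succ]
  have hS_meas : ∀ n, StronglyMeasurable[𝓕 n] (S n) := by
    intro n
    exact Finset.stronglyMeasurable_fun_sum _ fun k hk =>
      (hD_meas k).mono (𝓕.mono (Finset.mem_range.1 hk))
  have hS_L2 : ∀ n, MemLp (S n) 2 μ := fun n => memLp_finsetSum _ fun k _ => hD_L2 k
  have hS_int : ∀ n, Integrable (S n) μ := fun n => (hS_L2 n).integrable one_le_two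
  have hmart : Martingale S 𝓕 μ := by
    refine martingale_of_condExp_sub_eq_zero_nat hS_meas hS_int fun n => ?_
    rw [hS_succ, add_sub_cancel_left]
    exact hD_zero n
  -- Orthogonality of increments: `S n` is known at time `n` and pulls out of the conditional
  -- expectation.
  have hcross : ∀ n, ∫ ω, S n ω * D n ω ∂μ = 0 := by
    intro n
    have hint : Integrable (S n * D n) μ := (hS_L2 n).integrable_mul (hD_L2 n)
    have hpull := condExp_mul_of_stronglyMeasurable_left (hS_meas n) hint
      ((hD_L2 n).integrable one_le_two)
    have : ∫ ω, (μ[S n * D n | 𝓕 n]) ω ∂μ = ∫ ω, (S n * D n) ω ∂μ := integral_condExp (𝓕.le n)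
    rw [show (∫ ω, S n ω * D n ω ∂μ) = ∫ ω, (S n * D n) ω ∂μ from rfl, ← this]
    rw [integral_congr_ae hpull]
    refine integral_eq_zero_of_ae ?_
    filter_upwards [hD_zero n] with ω hω
    simp [hω]
  have hsq : ∀ n, ∫ ω, S n ω ^ 2 ∂μ ≤ ∑ k ∈ Finset.range n, c k := by
    intro n
    induction n with
    | zero => simp [hS]
    | succ n ih =>
      have h1 : Integrable (fun ω => S n ω ^ 2) μ := (hS_L2 n).integrable_sq
      have h2 : Integrable (fun ω => 2 * (S n ω * D n ω)) μ :=
        ((hS_L2 n).integrable_mul (hD_L2 n)).const_mul 2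
      have h3 : Integrable (fun ω => D n ω ^ 2) μ := (hD_L2 n).integrable_sq
      have : ∀ ω, S (n + 1) ω ^ 2 = S n ω ^ 2 + 2 * (S n ω * D n ω) + D n ω ^ 2 := fun ω => by
        rw [hS_succ]; simp only [Pi.add_apply]; ring
      simp_rw [this]
      have h12 : ∫ ω, (S n ω ^ 2 + 2 * (S n ω * D n ω)) ∂μ = ∫ ω, S n ω ^ 2 ∂μ := by
        rw [integral_add h1 h2, integral_const_mul, hcross, mul_zero, add_zero]
      rw [integral_add (f := fun ω => S n ω ^ 2 + 2 * (S n ω * D n ω)) (h1.add h2) h3, h12,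
        Finset.sum_range_succ]
      linarith [hD_sq n]
  have hc_nonneg : ∀ n, 0 ≤ c n := fun n =>
    (integral_nonneg fun ω => sq_nonneg (D n ω)).trans (hD_sq n)
  refine hmart.submartingale.exists_ae_tendsto_of_bdd (R := Real.toNNReal (1 + ∑' k, c k))
    fun n => ?_
  rw [eLpNorm_one_eq_lintegral_enorm, ← ofReal_integral_norm_eq_lintegral_enorm (hS_int n)]
  refine ENNReal.ofReal_le_ofReal ?_
  -- The L² bound gives an L¹ bound through `|s| ≤ 1 + s²`.
  have h1 : ∫ ω, ‖S n ω‖ ∂μ ≤ ∫ ω, (1 + S n ω ^ 2) ∂μ := by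
    refine integral_mono (hS_int n).norm ((integrable_const 1).add (hS_L2 n).integrable_sq)
      fun ω => ?_
    have := sq_nonneg (|S n ω| - 1)
    simp only [Real.norm_eq_abs]
    nlinarith [sq_abs (S n ω), abs_nonneg (S n ω)]
  rw [integral_add (integrable_const 1) (hS_L2 n).integrable_sq] at h1
  have h2 := hc.sum_le_tsum (Finset.range n) fun k _ => hc_nonneg k
  simp only [integral_const, probReal_univ, smul_eq_mul, mul_one] at h1
  linarith [hsq n]

end Martingale

/-! ### The filtration of histories -/

section History

variable {Ω E : Type*} [mE : MeasurableSpace E]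

theorem history_mono (x M : ℕ → Ω → E) : Monotone (history x M) := by
  intro n m hnm
  refine iSup_le fun k => ?_
  exact le_iSup_of_le (f := fun j : Fin (m + 1) =>
    MeasurableSpace.comap (x j) mE ⊔ MeasurableSpace.comap (M j) mE)
    ⟨k, by omega⟩ le_rfl

theorem history_le [mΩ : MeasurableSpace Ω] {x M : ℕ → Ω → E} (hx : ∀ n, Measurable (x n)) (hM : ∀ n, Measurable (M n)) (n : ℕ) :
    history x M n ≤ mΩ :=
  iSup_le fun k => sup_le (hx k).comap_le (hM k).comap_le

theorem measurable_history_fst (x M : ℕ → Ω → E) (n : ℕ) : Measurable[history x M n] (x n) :=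
  measurable_iff_comap_le.2 <| le_iSup_of_le (f := fun j : Fin (n + 1) =>
    MeasurableSpace.comap (x j) mE ⊔ MeasurableSpace.comap (M j) mE) (Fin.last n) le_sup_left

theorem measurable_history_snd (x M : ℕ → Ω → E) (n : ℕ) : Measurable[history x M n] (M n) :=
  measurable_iff_comap_le.2 <| le_iSup_of_le (f := fun j : Fin (n + 1) =>
    MeasurableSpace.comap (x j) mE ⊔ MeasurableSpace.comap (M j) mE) (Fin.last n) le_sup_right

/-- The filtration of the histories. -/
def historyFiltration [mΩ : MeasurableSpace Ω] {x M : ℕ → Ω → E} (hx : ∀ n, Measurable (x n))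
    (hM : ∀ n, Measurable (M n)) : Filtration ℕ mΩ where
  seq := history x M
  mono' := history_mono x M
  le' := history_le hx hM

end History

/-! ### Convergence of the weighted noise -/

section Noise

variable {d : ℕ} {Ω : Type*} [MeasurableSpace Ω] {μ : Measure Ω} [IsProbabilityMeasure μ]
  {a : ℕ → ℝ} {x M : ℕ → Ω → EuclideanSpace ℝ (Fin d)} {K : ℝ}

/-- The bound on the iterates is random, so the variances need truncation. The event `‖x k‖ ≤ R`
belongs to the history at time `k`, so truncating keeps martingale differences and bounds their
second moments by `|K| (1 + R²) a(k)²`. -/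
theorem ae_exists_tendsto_truncated_noise (a_sq : Summable (fun n => a n ^ 2))
    (hx : ∀ n, Measurable (x n)) (hM : ∀ n, Measurable (M n))
    (M_sq : ∀ n, MemLp (M n) 2 μ)
    (M_mart : ∀ n, μ[M (n + 1) | history x M n] =ᵐ[μ] 0)
    (M_var : ∀ n, μ[fun ω => ‖M (n + 1) ω‖ ^ 2 | history x M n]
      ≤ᵐ[μ] fun ω => K * (1 + ‖x n ω‖ ^ 2)) (R : ℝ) (i : Fin d) :
    ∀ᵐ ω ∂μ, ∃ l, Tendsto (fun n => ∑ k ∈ Finset.range n,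
      {ω | ‖x k ω‖ ≤ R}.indicator (fun ω => a k * M (k + 1) ω i) ω) atTop (𝓝 l) := by
  have hle := history_le hx hM
  let π : EuclideanSpace ℝ (Fin d) →L[ℝ] ℝ := EuclideanSpace.proj i
  have hset : ∀ n, MeasurableSet[history x M n] {ω | ‖x n ω‖ ≤ R} := fun n =>
    measurable_norm.comp (measurable_history_fst x M n) measurableSet_Iic
  have hset' : ∀ n, MeasurableSet {ω | ‖x n ω‖ ≤ R} := fun n => hle n _ (hset n)
  have hcoord : ∀ n, MemLp (fun ω => M n ω i) 2 μ := fun n =>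
    π.comp_memLp' (M_sq n)
  have hcoord_int : ∀ n, Integrable (fun ω => a n * M (n + 1) ω i) μ := fun n =>
    ((hcoord (n + 1)).integrable one_le_two).const_mul (a n)
  refine ae_exists_tendsto_sum_of_condExp_eq_zero (𝓕 := historyFiltration hx hM)
    (c := fun n => (|K| * (1 + R ^ 2)) * a n ^ 2) (fun n => ?_) (fun n => ?_) (fun n => ?_)
    (fun n => ?_) (a_sq.mul_left _)
  · have h1 : Measurable[history x M (n + 1)] (fun ω => a n * M (n + 1) ω i) :=
      Measurable.const_mul (π.measurable.comp (measurable_history_snd x M (n + 1))) (a n)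
    exact (h1.indicator (history_mono x M n.le_succ _ (hset n))).stronglyMeasurable
  · exact ((hcoord (n + 1)).const_mul (a n)).indicator (hset' n)
  · have h1 : μ[fun ω => a n * M (n + 1) ω i | history x M n] =ᵐ[μ] 0 := by
      have h2 := (a n • π).comp_condExp_comm
        (μ := μ) (m := history x M n) ((M_sq (n + 1)).integrable one_le_two)
      refine EventuallyEq.trans (EventuallyEq.symm ?_) (EventuallyEq.trans h2.symm ?_) 
      · exact EventuallyEq.rfl
      · filter_upwards [M_mart n] with ω hω
        simp [hω]
    refine (condExp_indicator (hcoord_int n) (hset n)).trans ?_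
    filter_upwards [h1] with ω hω
    simp [indicator, hω]
  · have hM2 : Integrable (fun ω => ‖M (n + 1) ω‖ ^ 2) μ := (M_sq (n + 1)).integrable_norm_pow two_ne_zero
    have h1 : ∫ ω, ({ω | ‖x n ω‖ ≤ R}.indicator (fun ω => a n * M (n + 1) ω i) ω) ^ 2 ∂μ
        ≤ ∫ ω in {ω | ‖x n ω‖ ≤ R}, a n ^ 2 * ‖M (n + 1) ω‖ ^ 2 ∂μ := by
      rw [← integral_indicator (hset' n)]
      refine integral_mono (((hcoord (n + 1)).const_mul (a n)).indicator (hset' n)).integrable_sq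
        ((hM2.const_mul _).indicator (hset' n)) fun ω => ?_
      by_cases hω : ω ∈ {ω | ‖x n ω‖ ≤ R}
      · simp only [indicator_of_mem hω, mul_pow]
        refine mul_le_mul_of_nonneg_left ?_ (sq_nonneg _)
        rw [← sq_abs]
        exact pow_le_pow_left₀ (abs_nonneg _) (PiLp.norm_apply_le (M (n + 1) ω) i) 2
      · simp [indicator_of_notMem hω]
    refine h1.trans ?_
    rw [integral_const_mul, ← setIntegral_condExp (hle n) hM2 (hset n), mul_comm]
    refine mul_le_mul_of_nonneg_right ?_ (sq_nonneg _)
    have h2 : ∫ ω in {ω | ‖x n ω‖ ≤ R}, (μ[fun ω => ‖M (n + 1) ω‖ ^ 2 | history x M n]) ω ∂μ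
        ≤ ∫ _ in {ω | ‖x n ω‖ ≤ R}, |K| * (1 + R ^ 2) ∂μ := by
      refine setIntegral_mono_on_ae integrable_condExp.integrableOn
        (integrable_const _).integrableOn (hset' n) ?_
      filter_upwards [M_var n] with ω hω hωR
      refine hω.trans ?_
      have h3 : ‖x n ω‖ ^ 2 ≤ R ^ 2 := pow_le_pow_left₀ (norm_nonneg _) hωR 2
      calc K * (1 + ‖x n ω‖ ^ 2) ≤ |K| * (1 + ‖x n ω‖ ^ 2) := by gcongr; exact le_abs_self K
        _ ≤ |K| * (1 + R ^ 2) := by gcongr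
    refine h2.trans ?_
    rw [setIntegral_const, smul_eq_mul]
    exact mul_le_of_le_one_left (by positivity) measureReal_le_one

/-- The weighted noise sums converge almost surely when the iterates are bounded. -/
theorem ae_exists_tendsto_noise (a_sq : Summable (fun n => a n ^ 2))
    (hx : ∀ n, Measurable (x n)) (hM : ∀ n, Measurable (M n))
    (M_sq : ∀ n, MemLp (M n) 2 μ)
    (M_mart : ∀ n, μ[M (n + 1) | history x M n] =ᵐ[μ] 0)
    (M_var : ∀ n, μ[fun ω => ‖M (n + 1) ω‖ ^ 2 | history x M n]
      ≤ᵐ[μ] fun ω => K * (1 + ‖x n ω‖ ^ 2))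
    (x_bdd : ∀ᵐ ω ∂μ, ∃ R : ℝ, ∀ n, ‖x n ω‖ ≤ R) :
    ∀ᵐ ω ∂μ, ∃ l, Tendsto (fun n => ∑ k ∈ Finset.range n, a k • M (k + 1) ω) atTop (𝓝 l) := by
  have hall : ∀ᵐ ω ∂μ, ∀ (N : ℕ) (i : Fin d), ∃ l, Tendsto (fun n => ∑ k ∈ Finset.range n,
      {ω | ‖x k ω‖ ≤ (N : ℝ)}.indicator (fun ω => a k * M (k + 1) ω i) ω) atTop (𝓝 l) :=
    ae_all_iff.2 fun N => ae_all_iff.2 fun i =>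
      ae_exists_tendsto_truncated_noise a_sq hx hM M_sq M_mart M_var N i
  filter_upwards [hall, x_bdd] with ω hω ⟨R, hR⟩
  -- For an integer level above the bound of this path, every truncation is inactive.
  obtain ⟨N, hN⟩ := exists_nat_ge R
  choose l hl using hω N
  refine ⟨WithLp.toLp 2 l, ?_⟩
  have hlim := ((PiLp.continuous_toLp 2 (fun _ : Fin d => ℝ)).tendsto l).comp (tendsto_pi_nhds.2 hl)
  refine hlim.congr fun n => ?_
  ext i
  simp only [Function.comp_apply, WithLp.ofLp_sum, Finset.sum_apply]
  refine Finset.sum_congr rfl fun k _ => ?_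
  rw [indicator_of_mem (show ω ∈ {ω | ‖x k ω‖ ≤ (N : ℝ)} from (hR k).trans hN)]
  simp

end Noise

/-! ### Interpolation versus noise-free path -/

section Tracking

variable {E : Type*} [NormedAddCommGroup E] [NormedSpace ℝ E] {a : ℕ → ℝ} {x v m : ℕ → E} {C : ℝ}
  {l : E}

theorem norm_interpolation_sub_le (ht : Tendsto (time a) atTop atTop) {s : ℝ} (hs : 0 ≤ s) :
    ‖interpolation a x s - x (pieceIndex a s)‖
      ≤ ‖x (pieceIndex a s + 1) - x (pieceIndex a s)‖ := by
  have h1 := time_pieceIndex_le (a := a) hs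
  have h2 := lt_time_pieceIndex_succ ht s
  rw [time_succ] at h2
  rw [interpolation, add_sub_cancel_left, norm_smul]
  refine mul_le_of_le_one_left (norm_nonneg _) ?_
  rw [Real.norm_of_nonneg (div_nonneg (by linarith) (by linarith))]
  exact div_le_one_of_le₀ (by linarith) (by linarith)

theorem iterate_eq_sum (hx : ∀ n, x (n + 1) = x n + a n • (v n + m n)) (n : ℕ) :
    x n = x 0 + ∑ k ∈ Finset.range n, a k • v k + ∑ k ∈ Finset.range n, a k • m k := by
  induction n with
  | zero => simp
  | succ n ih =>
    rw [hx, Finset.sum_range_succ, Finset.sum_range_succ, smul_add]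
    nth_rewrite 1 [ih]
    abel

/-- The noise-free path driven by the values `v`, shifted by the total noise `l`. -/
noncomputable def driftPath (a : ℕ → ℝ) (x v : ℕ → E) (l : E) (s : ℝ) : E :=
  x 0 + l + integratedDrift a v s

/-- The difference is the noise still to come, plus the drift over part of one step, at most `C * a
k`. -/
theorem tendsto_iterate_sub_driftPath [CompleteSpace E] (ha : ∀ n, 0 ≤ a n)
    (ht : Tendsto (time a) atTop atTop) (ha0 : Tendsto a atTop (𝓝 0)) (hv : ∀ k, ‖v k‖ ≤ C)
    (hx : ∀ n, x (n + 1) = x n + a n • (v n + m n))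
    (hm : Tendsto (fun n => ∑ k ∈ Finset.range n, a k • m k) atTop (𝓝 l)) :
    Tendsto (fun s => x (pieceIndex a s) - driftPath a x v l s) atTop (𝓝 0) := by
  have hC : 0 ≤ C := (norm_nonneg _).trans (hv 0)
  have hlim : Tendsto (fun k => ‖(∑ j ∈ Finset.range k, a j • m j) - l‖ + C * a k)
      atTop (𝓝 0) := by
    simpa using (tendsto_iff_norm_sub_tendsto_zero.1 hm).add (ha0.const_mul C)
  refine squeeze_zero_norm' ?_ (hlim.comp (tendsto_pieceIndex ha ht))
  filter_upwards [eventually_ge_atTop 0] with s hs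
  simp only [Function.comp_apply]
  set k := pieceIndex a s with hk
  have h1 := time_pieceIndex_le (a := a) hs
  have h2 := lt_time_pieceIndex_succ ht s
  rw [time_succ] at h2
  have h3 : x k - driftPath a x v l s = ((∑ j ∈ Finset.range k, a j • m j) - l)
      + (integratedDrift a v (time a k) - integratedDrift a v s) := by
    rw [integratedDrift_time ha ht hv, iterate_eq_sum hx k, driftPath]
    abel
  rw [h3]
  refine (norm_add_le _ _).trans (add_le_add le_rfl
    ((norm_integratedDrift_sub_le ht hv _ _).trans ?_))
  gcongr
  rw [abs_le]
  constructor <;> linarith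

theorem tendsto_interpolation_sub_driftPath [CompleteSpace E] (ha : ∀ n, 0 ≤ a n)
    (ht : Tendsto (time a) atTop atTop) (ha0 : Tendsto a atTop (𝓝 0)) (hv : ∀ k, ‖v k‖ ≤ C)
    (hx : ∀ n, x (n + 1) = x n + a n • (v n + m n))
    (hm : Tendsto (fun n => ∑ k ∈ Finset.range n, a k • m k) atTop (𝓝 l)) :
    Tendsto (fun s => interpolation a x s - driftPath a x v l s) atTop (𝓝 0) := by
  have hstep : Tendsto (fun k => x (k + 1) - x k) atTop (𝓝 0) := by
    have h1 : Tendsto (fun k => a k • v k) atTop (𝓝 0) := by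
      refine squeeze_zero_norm (a := fun k => a k * C) (fun k => ?_) (by simpa using ha0.mul_const C)
      rw [norm_smul, Real.norm_of_nonneg (ha k)]
      exact mul_le_mul_of_nonneg_left (hv k) (ha k)
    have h2 : Tendsto (fun k => a k • m k) atTop (𝓝 0) := by
      simpa [Finset.sum_range_succ] using ((tendsto_add_atTop_iff_nat 1).2 hm).sub hm
    simpa [hx, smul_add] using h1.add h2
  have h3 : Tendsto (fun s => interpolation a x s - x (pieceIndex a s)) atTop (𝓝 0) := by
    refine squeeze_zero_norm' ((eventually_ge_atTop 0).mono fun s hs =>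
      norm_interpolation_sub_le ht hs) ?_
    simpa using (hstep.comp (tendsto_pieceIndex ha ht)).norm
  simpa using h3.add (tendsto_iterate_sub_driftPath ha ht ha0 hv hx hm)

end Tracking

/-! ### Limit paths and Filippov solutions -/

section Limit

variable {d : ℕ} {h : EuclideanSpace ℝ (Fin d) → EuclideanSpace ℝ (Fin d)} {a : ℕ → ℝ}
  {x m : ℕ → EuclideanSpace ℝ (Fin d)} {l : EuclideanSpace ℝ (Fin d)} {C : NNReal} {R : ℝ}

theorem lipschitzWith_driftPath {E : Type*} [NormedAddCommGroup E] [NormedSpace ℝ E] {v : ℕ → E}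
    (ht : Tendsto (time a) atTop atTop) (hv : ∀ k, ‖v k‖ ≤ C) (x : ℕ → E) (l : E) :
    LipschitzWith C (driftPath a x v l) := by
  refine LipschitzWith.of_dist_le_mul fun s s' => ?_
  rw [dist_eq_norm, driftPath, driftPath, add_sub_add_left_eq_sub, Real.dist_eq]
  exact norm_integratedDrift_sub_le ht hv s' s

/-- Every ultrafilter limit of the time-shifted noise-free path is a Filippov solution. -/
theorem exists_ultrafilter_limit {N₀ : Set (EuclideanSpace ℝ (Fin d))}
    (hN₀ : ∀ z v, (∀ δ > 0, v ∈ closure (convexHull ℝ (h '' (Metric.ball z δ \ N₀)))) →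
      v ∈ filippovMap h z)
    (hxN : ∀ k, x k ∉ N₀) (hR : ∀ k, ‖x k‖ ≤ R) (ht : Tendsto (time a) atTop atTop)
    (hv : ∀ k, ‖h (x k)‖ ≤ C)
    (hclose : Tendsto (fun s => x (pieceIndex a s) - driftPath a x (fun k => h (x k)) l s)
      atTop (𝓝 0)) (L : Ultrafilter ℕ) (hL : (L : Filter ℕ) ≤ atTop) :
    ∃ y : ℝ → EuclideanSpace ℝ (Fin d), LipschitzWith C y ∧
      (∀ s, Tendsto (fun n => driftPath a x (fun k => h (x k)) l (time a n + s)) L (𝓝 (y s))) ∧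
      ∀ s v, HasDerivAt y v s → v ∈ filippovMap h (y s) := by
  set u := driftPath a x (fun k => h (x k)) l with hu
  have hu_lip : LipschitzWith C u := lipschitzWith_driftPath ht hv x l
  have hshift : ∀ s, Tendsto (fun n => time a n + s) L atTop := fun s =>
    (tendsto_atTop_add_const_right _ s ht).mono_left hL
  -- Negative `s` are included since `t(n) + s → ∞`; the limit lives on all of `ℝ` and has two-sided
  -- derivatives.
  have hlim : ∀ s, ∃ z, Tendsto (fun n => u (time a n + s)) L (𝓝 z) := by
    intro s
    have hb : ∀ᶠ r in atTop, u r ∈ Metric.closedBall (0 : EuclideanSpace ℝ (Fin d)) (R + 1) := by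
      filter_upwards [(Metric.tendsto_nhds.1 hclose) 1 one_pos] with r hr
      rw [dist_zero_right] at hr
      rw [mem_closedBall_zero_iff]
      have := norm_sub_norm_le (u r) (x (pieceIndex a r))
      rw [norm_sub_rev] at this
      linarith [hR (pieceIndex a r)]
    obtain ⟨z, -, hz⟩ := (isCompact_closedBall _ _).ultrafilter_le_nhds
      (L.map fun n => u (time a n + s)) (le_principal_iff.2 ((hshift s).eventually hb))
    exact ⟨z, hz⟩
  choose y hy using hlim
  have hy_lip : LipschitzWith C y := LipschitzWith.of_dist_le_mul fun s s' =>
    le_of_tendsto ((hy s).dist (hy s')) <| Eventually.of_forall fun n => by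
      simpa using hu_lip.dist_le_mul (time a n + s) (time a n + s')
  refine ⟨y, hy_lip, hy, fun s v hsv => hN₀ _ _ fun δ hδ => ?_⟩
  set G := closure (convexHull ℝ (h '' (Metric.ball (y s) δ \ N₀))) with hG
  have hslope : ∀ᶠ s' in 𝓝[>] s, slope y s s' ∈ G := by
    -- Budget for `x (pieceIndex a r)` to be `δ`-close to `y s`: `δ/4` from iterate to `u`, `δ/2` by
    -- the Lipschitz bound over this time span, `δ/4` from `u` to its limit.
    have hη : 0 < δ / (2 * (C + 1)) := by positivity
    filter_upwards [Ioo_mem_nhdsGT (show s < s + δ / (2 * (C + 1)) by linarith)] with s' hs'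
    have hmem : ∀ᶠ n in (L : Filter ℕ),
        (s' - s)⁻¹ • (u (time a n + s') - u (time a n + s)) ∈ G := by
      obtain ⟨r₀, hr₀⟩ := eventually_atTop.1
        ((Metric.tendsto_nhds.1 hclose) (δ / 4) (by positivity))
      filter_upwards [(hshift s).eventually_ge_atTop r₀,
        (Metric.tendsto_nhds.1 (hy s)) (δ / 4) (by positivity)] with n hn hn'
      have := integratedDrift_slope_mem (b := time a n + s) (c := time a n + s') ht hv
        (convex_convexHull ℝ (h '' (Metric.ball (y s) δ \ N₀))).closure isClosed_closure
        (by linarith [hs'.1]) fun r hr => ?_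
      · rw [hu, driftPath, driftPath, add_sub_add_left_eq_sub]
        rwa [add_sub_add_left_eq_sub] at this
      · refine subset_closure (subset_convexHull ℝ _ ⟨x (pieceIndex a r), ⟨?_, hxN _⟩, rfl⟩)
        have h1 := hr₀ r (hn.trans hr.1)
        rw [dist_zero_right, ← dist_eq_norm] at h1
        have h2 := hu_lip.dist_le_mul r (time a n + s)
        have h3 : (C : ℝ) * dist r (time a n + s) ≤ δ / 2 := by
          have h4 : dist r (time a n + s) ≤ δ / (2 * (C + 1)) := by
            rw [Real.dist_eq, abs_of_nonneg (by linarith [hr.1])]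
            linarith [hr.2, hs'.2]
          calc (C : ℝ) * dist r (time a n + s) ≤ (C + 1) * (δ / (2 * (C + 1))) := by
                gcongr; linarith
            _ = δ / 2 := by field_simp
        rw [Metric.mem_ball]
        have h5 := dist_triangle4 (x (pieceIndex a r)) (u r) (u (time a n + s)) (y s)
        linarith
    rw [slope_def_module]
    exact isClosed_closure.mem_of_tendsto (((hy s').sub (hy s)).const_smul _) hmem
  have hsub : Ioi s ⊆ {s}ᶜ := fun r (hr : s < r) => hr.ne'
  exact isClosed_closure.mem_of_tendsto
    ((hasDerivAt_iff_tendsto_slope.1 hsv).mono_left (nhdsWithin_mono _ hsub)) hslope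

/-- Lipschitz paths are absolutely continuous and, by Rademacher, differentiable almost everywhere;
the inclusion is autonomous, so time shifts are harmless. -/
theorem isFilippovSolution_shift {y : ℝ → EuclideanSpace ℝ (Fin d)} (hy : LipschitzWith C y)
    (hderiv : ∀ s v, HasDerivAt y v s → v ∈ filippovMap h (y s)) (b c e : ℝ) :
    IsFilippovSolution h (fun s => y (s - e)) b c := by
  have hlip : LipschitzWith C (fun s => y (s - e)) := LipschitzWith.of_dist_le_mul fun s s' => by
    simpa using hy.dist_le_mul (s - e) (s' - e)
  refine ⟨hlip.lipschitzOnWith.absolutelyContinuousOnInterval, ?_⟩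
  refine ae_restrict_of_ae ?_
  filter_upwards [hlip.ae_differentiableAt_real] with s hs
  refine ⟨_, hderiv (s - e) _ ?_, hs.hasDerivAt⟩
  have h1 : HasDerivAt (fun s => y (s - e)) (deriv (fun s => y (s - e)) s) (s - e + e) := by
    simpa using hs.hasDerivAt
  simpa using h1.comp_add_const (s - e) e

/-- A bounded stochastic approximation path that avoids a suitable null set, with convergent
weighted noise, asymptotically tracks Filippov solutions. -/
theorem exists_tracking_solutions {N₀ : Set (EuclideanSpace ℝ (Fin d))}
    (hN₀ : ∀ z v, (∀ δ > 0, v ∈ closure (convexHull ℝ (h '' (Metric.ball z δ \ N₀)))) →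
      v ∈ filippovMap h z)
    (hxN : ∀ k, x k ∉ N₀) (hR : ∀ k, ‖x k‖ ≤ R) (ha : ∀ n, 0 ≤ a n)
    (ht : Tendsto (time a) atTop atTop) (ha0 : Tendsto a atTop (𝓝 0)) (hv : ∀ k, ‖h (x k)‖ ≤ C)
    (hx : ∀ n, x (n + 1) = x n + a n • (h (x n) + m n))
    (hm : Tendsto (fun n => ∑ k ∈ Finset.range n, a k • m k) atTop (𝓝 l)) {T : ℝ} (hT : 0 < T) :
    ∃ y : ℕ → ℝ → EuclideanSpace ℝ (Fin d),
      (∀ n, IsFilippovSolution h (y n) (time a n) (time a (horizonIndex a T n))) ∧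
      Tendsto (fun n => ⨆ s ∈ Icc (time a n) (time a (horizonIndex a T n)),
        ‖interpolation a x s - y n s‖ₑ) atTop (𝓝 0) := by
  set u := driftPath a x (fun k => h (x k)) l with hu
  have hu_lip : LipschitzWith C u := lipschitzWith_driftPath ht hv x l
  have hclose := tendsto_iterate_sub_driftPath ha ht ha0 hv hx hm
  have hinterp := tendsto_interpolation_sub_driftPath ha ht ha0 hv hx hm
  obtain ⟨A, hA⟩ := ha0.bddAbove_range
  have hA' : ∀ n, a n ≤ A := fun n => hA ⟨n, rfl⟩
  have hlimit := exists_ultrafilter_limit hN₀ hxN hR ht hv hclose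
  let I : ℕ → Set ℝ := fun n => Icc (time a n) (time a (horizonIndex a T n))
  let Sol : ℕ → Set (ℝ → EuclideanSpace ℝ (Fin d)) := fun n =>
    {z | IsFilippovSolution h z (time a n) (time a (horizonIndex a T n))}
  let err : ℕ → (ℝ → EuclideanSpace ℝ (Fin d)) → ENNReal := fun n z =>
    ⨆ s ∈ I n, ‖interpolation a x s - z s‖ₑ
  -- The limit `y` depends on the ultrafilter, but the least error `D n` does not, so its
  -- convergence can be tested on ultrafilters.
  let D : ℕ → ENNReal := fun n => ⨅ z ∈ Sol n, err n z
  have hD : Tendsto D atTop (𝓝 0) := by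
    rw [tendsto_iff_ultrafilter]
    intro L hL
    obtain ⟨y, hy_lip, hy, hderiv⟩ := hlimit L hL
    have hunif : TendstoUniformlyOn (fun n s => u (time a n + s)) y L (Icc 0 (T + A)) :=
      tendstoUniformlyOn_of_lipschitz (fun n => LipschitzWith.of_dist_le_mul fun s s' => by
        simpa using hu_lip.dist_le_mul (time a n + s) (time a n + s')) hy_lip hy
        isCompact_Icc.totallyBounded
    rw [ENNReal.tendsto_nhds_zero]
    intro ε hε
    obtain ⟨ε', hε'0, hε'⟩ : ∃ ε' : ℝ, 0 < ε' ∧ ENNReal.ofReal ε' ≤ ε := by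
      rcases eq_or_ne ε ⊤ with rfl | htop
      · exact ⟨1, one_pos, le_top⟩
      · exact ⟨ε.toReal, ENNReal.toReal_pos hε.ne' htop, ENNReal.ofReal_toReal_le⟩
    obtain ⟨r₀, hr₀⟩ := eventually_atTop.1
      ((Metric.tendsto_nhds.1 hinterp) (ε' / 2) (by positivity))
    filter_upwards [(ht.mono_left hL).eventually_ge_atTop r₀,
      Metric.tendstoUniformlyOn_iff.1 hunif (ε' / 2) (by positivity)] with n hn hn'
    refine (iInf₂_le (fun s => y (s - time a n))
      (isFilippovSolution_shift hy_lip hderiv _ _ _)).trans ?_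
    refine iSup₂_le fun s hs => le_trans ?_ hε'
    rw [← ofReal_norm]
    refine ENNReal.ofReal_le_ofReal ?_
    have h1 := hr₀ s (hn.trans hs.1)
    have h2 := hn' (s - time a n) ⟨by linarith [hs.1], by
      linarith [hs.2, time_horizonIndex_le hA' ((ha 0).trans (hA' 0)) ha hT n]⟩
    rw [dist_zero_right] at h1
    rw [add_sub_cancel, dist_eq_norm, norm_sub_rev] at h2
    have h3 := norm_sub_le_norm_sub_add_norm_sub (interpolation a x s) (u s) (y (s - time a n))
    linarith
  have hne : ∀ n, ∃ z, z ∈ Sol n := by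
    intro n
    obtain ⟨y, hy_lip, -, hderiv⟩ := hlimit (hyperfilter ℕ) Nat.hyperfilter_le_atTop
    exact ⟨_, isFilippovSolution_shift hy_lip hderiv _ _ 0⟩
  -- The infimum need not be attained, hence the vanishing slack; where `D n = ⊤` any solution
  -- serves.
  have hex : ∀ n, ∃ z ∈ Sol n, err n z ≤ D n + ENNReal.ofReal (1 / ((n : ℝ) + 1)) := by
    intro n
    rcases eq_or_ne (D n) ⊤ with htop | htop
    · obtain ⟨z, hz⟩ := hne n
      exact ⟨z, hz, by simp [htop]⟩
    · have hlt : D n < D n + ENNReal.ofReal (1 / ((n : ℝ) + 1)) :=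
        ENNReal.lt_add_right htop (ENNReal.ofReal_pos.2 (by positivity)).ne'
      obtain ⟨z, hz, hzlt⟩ : ∃ z ∈ Sol n, err n z < D n + ENNReal.ofReal (1 / ((n : ℝ) + 1)) := by
        simpa only [D, iInf_lt_iff, exists_prop] using hlt
      exact ⟨z, hz, hzlt.le⟩
  choose y hy hyD using hex
  refine ⟨y, hy, tendsto_of_tendsto_of_tendsto_of_le_of_le tendsto_const_nhds ?_
    (fun n => zero_le) hyD⟩
  simpa using hD.add (ENNReal.tendsto_ofReal (tendsto_one_div_add_atTop_nhds_zero_nat (𝕜 := ℝ)))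

end Limit

end StochApprox

theorem theorem3 {d : ℕ} {Ω : Type*} [MeasurableSpace Ω] (μ : Measure Ω) [IsProbabilityMeasure μ]
    (h : EuclideanSpace ℝ (Fin d) → EuclideanSpace ℝ (Fin d))
    (a : ℕ → ℝ) (x M : ℕ → Ω → EuclideanSpace ℝ (Fin d)) (K : ℝ)
    -- `h` is measurable and locally bounded
    (h_meas : Measurable h)
    (h_bdd : ∀ R : ℝ, ∃ C : ℝ, ∀ z, ‖z‖ ≤ R → ‖h z‖ ≤ C)
    -- step sizes
    (a_nonneg : ∀ n, 0 ≤ a n)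
    (a_sum : Tendsto (StochApprox.time a) atTop atTop)
    (a_sq : Summable (fun n => a n ^ 2))
    -- the iteration
    (x_meas : Measurable (x 0))
    (M_meas : ∀ n, Measurable (M n))
    (iter : ∀ n ω, x (n + 1) ω = x n ω + a n • (h (x n ω) + M (n + 1) ω))
    -- martingale difference noise with controlled conditional variance
    (M_sq : ∀ n, MemLp (M n) 2 μ)
    (M_mart : ∀ n, μ[M (n + 1) | StochApprox.history x M n] =ᵐ[μ] 0)
    (M_var : ∀ n, μ[fun ω => ‖M (n + 1) ω‖ ^ 2 | StochApprox.history x M n]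
      ≤ᵐ[μ] fun ω => K * (1 + ‖x n ω‖ ^ 2))
    -- a.s. boundedness of the iterates
    (x_bdd : ∀ᵐ ω ∂μ, ∃ R : ℝ, ∀ n, ‖x n ω‖ ≤ R)
    -- absolute continuity of the joint laws
    (law_ac : ∀ n, μ.map (fun ω => (x n ω, M (n + 1) ω)) ≪ volume) :
    ∀ᵐ ω ∂μ, ∀ T : ℝ, 0 < T →
      ∃ y : ℕ → ℝ → EuclideanSpace ℝ (Fin d),
        (∀ n, StochApprox.IsFilippovSolution h (y n) (StochApprox.time a n)
          (StochApprox.time a (StochApprox.horizonIndex a T n))) ∧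
        Tendsto (fun n => ⨆ s ∈ Icc (StochApprox.time a n)
            (StochApprox.time a (StochApprox.horizonIndex a T n)),
          ‖StochApprox.interpolation a (fun k => x k ω) s - y n s‖ₑ) atTop (𝓝 0) := by
  have hx : ∀ n, Measurable (x n) := by
    intro n
    induction n with
    | zero => exact x_meas
    | succ n ih =>
      have : x (n + 1) = fun ω => x n ω + a n • (h (x n ω) + M (n + 1) ω) := funext (iter n)
      rw [this]
      exact ih.add (((h_meas.comp ih).add (M_meas (n + 1))).const_smul (a n))
  have ha0 : Tendsto a atTop (𝓝 0) := by
    have := a_sq.tendsto_atTop_zero.sqrt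
    simpa [Real.sqrt_sq (a_nonneg _)] using this
  obtain ⟨N₀, hN₀, hF⟩ := StochApprox.exists_null_filippovMap h
  have havoid : ∀ᵐ ω ∂μ, ∀ n, x n ω ∉ N₀ := by
    refine ae_all_iff.2 fun n => ?_
    -- The cylinder over `N₀` is null in the product, so the joint law does not charge it.
    have h1 : ∀ᵐ p : EuclideanSpace ℝ (Fin d) × EuclideanSpace ℝ (Fin d), p.1 ∉ N₀ :=
      Measure.quasiMeasurePreserving_fst.ae (measure_eq_zero_iff_ae_notMem.1 hN₀)
    exact ae_of_ae_map ((hx n).prodMk (M_meas (n + 1))).aemeasurable ((law_ac n).ae_le h1)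
  -- The exceptional event is fixed before `T`, so one null set serves all horizons.
  filter_upwards [havoid, x_bdd,
    StochApprox.ae_exists_tendsto_noise a_sq hx M_meas M_sq M_mart M_var x_bdd]
    with ω hω ⟨R, hR⟩ ⟨l, hl⟩ T hT
  obtain ⟨C, hC⟩ := h_bdd R
  exact StochApprox.exists_tracking_solutions (C := C.toNNReal) (m := fun n => M (n + 1) ω) hF hω hR
    a_nonneg a_sum ha0 (fun k => (hC _ (hR k)).trans (Real.le_coe_toNNReal C))
    (fun n => iter n ω) hl hT
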